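/- Let $d \in \mathbb{Z}$ and $k \in \mathbb{Z} \cup \{\infty\}$ with $0 \le d < k \le \infty$. For integers $n, W \ge 0$ let $S_{d,k}(n,W)$ be the number of binary strings of length $n$ and Hamming weight $W$ that are concatenations of blocks $0^j1$ with $d \le j \le k$ ($j$ finite). Let $\log$ be the base-$2$ logarithm and put $\frac{1}{k+1} = 0$ if $k = \infty$; all sums below are over the integers $i$ with $d+1 \le i \le k+1$ (over all integers $i \ge d+1$ if $k = \infty$, in which case solutions of equations are understood with convergent series). Let $\rho$ be the positive solution of $\sum_i x^i = 1$, which exists and is unique. For $w \in \big(\frac{1}{k+1}, \frac{1}{d+1}\big)$ the equation $\sum_i (wi-1)x^i = 0$ has a unique positive solution $\rho_w$; define $$\sigma_{d,k}(w) = w \log \sum_i \rho_w^{\,i - 1/w}$$ (a convergent sum), and let $\sigma_{d,k}\big(\frac{1}{k+1}\big) = \sigma_{d,k}\big(\frac{1}{d+1}\big) = 0$. (a) Fix $w \in \big[\frac{1}{k+1}, \frac{1}{d+1}\big]$ and let $(W_n)$ be nonnegative integers with $|W_n - wn| \le 1$ for all $n$ (that is, $W_n$ is $wn$ rounded to an integer)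 and $S_{d,k}(n,W_n) > 0$ for all large $n$. Then $$\lim_{n\to\infty} \frac{1}{n} \log S_{d,k}(n, W_n) = \sigma_{d,k}(w).$$ The positivity requirement is automatic for every such $(W_n)$ if $\frac{1}{k+1} < w < \frac{1}{d+1}$; it holds for $W_n = \lfloor wn \rfloor$ if $w = \frac{1}{d+1}$, and for $W_n = \max\{1, \lceil wn \rceil\}$ if $w = \frac{1}{k+1}$. (b) The function $\sigma_{d,k}$ is continuous and strictly concave on $\big[\frac{1}{k+1}, \frac{1}{d+1}\big]$. It attains its maximum at $w^* = \big(\sum_i i\rho^i\big)^{-1}$, which lies in $\big(\frac{1}{k+1}, \frac{1}{d+1}\big)$, and $\sigma_{d,k}(w^*) = -\log \rho$. -/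

import Mathlib

open Filter Topology Set
open scoped Computability

noncomputable section

namespace RunLength

/-- The set of blocks `{0^d 1, ..., 0^k 1}`; for `k = ⊤` all blocks `0^j 1` with `d ≤ j`. -/
def blocks (d : ℕ) (k : ℕ∞) : Language Bool :=
  {x | ∃ j : ℕ, d ≤ j ∧ (j : ℕ∞) ≤ k ∧ x = List.replicate j false ++ [true]}

/-- The `(d,k)`-constrained strings of length `n`: binary strings of length `n` that are
concatenations of blocks. -/
def inputs (d : ℕ) (k : ℕ∞) (n : ℕ) : Set (List Bool) :=
  {x | x.length = n ∧ x ∈ (blocks d k)∗}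

/-- The `(d,k)`-constrained strings of length `n` and Hamming weight `W`. -/
def inputsW (d : ℕ) (k : ℕ∞) (n W : ℕ) : Set (List Bool) :=
  {x | x ∈ inputs d k n ∧ x.count true = W}

/-- The number of `(d,k)`-constrained strings of length `n` and Hamming weight `W`. -/
def S (d : ℕ) (k : ℕ∞) (n W : ℕ) : ℕ := (inputsW d k n W).ncard

/-- The index set `{d+1, ..., k+1}` of the sums; it is `{d+1, d+2, ...}` for `k = ⊤`. -/
def parts (d : ℕ) (k : ℕ∞) : Set ℕ := {i | d + 1 ≤ i ∧ (i : ℕ∞) ≤ k + 1}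

/-- The left endpoint `1/(k+1)` of the weight interval, equal to `0` for `k = ⊤`. -/
def wMin (k : ℕ∞) : ℝ := if k = ⊤ then 0 else 1 / ((k.toNat : ℝ) + 1)

/-- The right endpoint `1/(d+1)` of the weight interval. -/
def wMax (d : ℕ) : ℝ := 1 / ((d : ℝ) + 1)

/-- `x` is a positive solution to `∑ (w i - 1) x^i = 0`, sum over `d+1 ≤ i ≤ k+1`
(a convergent sum if `k = ⊤`). -/
def IsRhoW (d : ℕ) (k : ℕ∞) (w x : ℝ) : Prop :=
  0 < x ∧ HasSum (fun i : parts d k => (w * ((i : ℕ) : ℝ) - 1) * x ^ (i : ℕ)) 0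

/-- `x` is a positive solution to `∑ x^i = 1`, sum over `d+1 ≤ i ≤ k+1`
(a convergent sum if `k = ⊤`). -/
def IsRho (d : ℕ) (k : ℕ∞) (x : ℝ) : Prop :=
  0 < x ∧ HasSum (fun i : parts d k => x ^ (i : ℕ)) 1

/-- The positive solution `ρ_w` to `∑ (w i - 1) x^i = 0`. -/
def rhoW (d : ℕ) (k : ℕ∞) (w : ℝ) : ℝ := Classical.epsilon (IsRhoW d k w)

/-- The positive solution `ρ` to `∑ x^i = 1`. -/
def rho (d : ℕ) (k : ℕ∞) : ℝ := Classical.epsilon (IsRho d k)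

open Classical in
/-- The exponent `σ(w) = w log₂ ∑ ρ_w^(i - 1/w)` in the open weight interval, and `0` at its
endpoints. (Values outside the closed interval play no role.) -/
def sigma (d : ℕ) (k : ℕ∞) (w : ℝ) : ℝ :=
  if w ∈ Ioo (wMin k) (wMax d) then
    w * Real.logb 2 (∑' i : parts d k, (rhoW d k w) ^ (((i : ℕ) : ℝ) - 1 / w))
  else 0

/-- The weight `w* = (∑ i ρ^i)⁻¹`. -/
def wStar (d : ℕ) (k : ℕ∞) : ℝ :=
  (∑' i : parts d k, ((i : ℕ) : ℝ) * (rho d k) ^ (i : ℕ))⁻¹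

/-- `W` arises from `n ↦ w n` by rounding to an integer, in whatever way. -/
def IsRounding (w : ℝ) (W : ℕ → ℕ) : Prop := ∀ n : ℕ, |(W n : ℝ) - w * (n : ℝ)| ≤ 1

end RunLength

end

noncomputable section

namespace RunLength

/-! A string of weight W splits uniquely into W blocks, so with g(x) = ∑ x^i the number S(n,W) is
the coefficient of x^n in g(x)^W. Every x at which g converges thus gives S(n,W) ≤ g(x)^W x^(-n),
and w log g(x) - log x bounds the growth rate. By convexity in log x this exponent is strictly
minimal at its stationary point, given by the equation for ρ_w (`expo_lt_of_isRhoW`); up to the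
factor log 2, σ(w) is that minimum.

The bound is tight. Under weights proportional to ρ_w^i a block has mean length 1/w, so by
Chebyshev's inequality (`exists_large_S`) most of the weight of g^W sits at lengths near W/w.
Keeping o(n) blocks in reserve, with lengths chosen freely, brings the total to exactly n
(`le_log_S`).

For (b), σ is an infimum of functions affine in w, one for each x, hence concave; strictly so,
because an x solves the equation for only one w. At the two endpoints the infimum is 0, approached
at an end of the domain of g but not attained. The choice x = ρ gives a constant function, as g(ρ) =
1, and this constant is attained at w*. -/

/-- The generating function `∑ x^i` of the block lengths. -/
def genSum (d : ℕ) (k : ℕ∞) (x : ℝ) : ℝ := ∑' i : parts d k, x ^ (i : ℕ)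

/-- The positive reals at which the generating function converges. -/
def domain (d : ℕ) (k : ℕ∞) : Set ℝ := {x | 0 < x ∧ Summable fun i : parts d k => x ^ (i : ℕ)}

/-- The natural-log exponent `w log ∑ x^i - log x`, whose minimum over `x` is `σ(w) log 2`. -/
def expo (d : ℕ) (k : ℕ∞) (w x : ℝ) : ℝ := w * Real.log (genSum d k x) - Real.log x

/-! ### The index set and the domain of convergence -/

variable {d : ℕ} {k : ℕ∞} {w x y : ℝ}

lemma hasSum_of_forall_eq {ι : Type*} {f g : ι → ℝ} {a : ℝ} (h : ∀ i, f i = g i)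
    (hg : HasSum g a) : HasSum f a := by
  rwa [funext h]

lemma mem_parts_coe {K i : ℕ} : i ∈ parts d (K : ℕ∞) ↔ d + 1 ≤ i ∧ i ≤ K + 1 := by
  simp only [parts, mem_ofPred_eq]
  norm_cast

lemma mem_parts_top {i : ℕ} : i ∈ parts d ⊤ ↔ d + 1 ≤ i := by
  simp [parts]

lemma mem_parts_of_le {K i : ℕ} (hK : (K : ℕ∞) ≤ k) (h1 : d + 1 ≤ i) (h2 : i ≤ K + 1) :
    i ∈ parts d k := by
  refine ⟨h1, ?_⟩
  calc (i : ℕ∞) ≤ ((K + 1 : ℕ) : ℕ∞) := by exact_mod_cast h2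
    _ = (K : ℕ∞) + 1 := by push_cast; rfl
    _ ≤ k + 1 := by gcongr

lemma first_mem_parts (hdk : (d : ℕ∞) < k) : d + 1 ∈ parts d k :=
  mem_parts_of_le hdk.le le_rfl le_rfl

lemma second_mem_parts (hdk : (d : ℕ∞) < k) : d + 2 ∈ parts d k := by
  refine mem_parts_of_le (K := d + 1) ?_ (by omega) le_rfl
  push_cast
  exact Order.add_one_le_of_lt hdk

instance finite_parts_coe (K : ℕ) : Finite (parts d (K : ℕ∞)) :=
  Set.Finite.to_subtype ((Set.finite_Icc (d + 1) (K + 1)).subset fun _ hi => mem_parts_coe.1 hi)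

/-- With unbounded blocks the parts are enumerated by `j ↦ j + (d + 1)`. -/
def natEquivParts (d : ℕ) : ℕ ≃ parts d ⊤ where
  toFun j := ⟨j + (d + 1), mem_parts_top.2 (by omega)⟩
  invFun i := i - (d + 1)
  left_inv j := by simp
  right_inv i := by
    have := mem_parts_top.1 i.2
    ext; simp; omega

@[simp] lemma natEquivParts_coe (j : ℕ) : (natEquivParts d j : ℕ) = j + (d + 1) := rfl

lemma lt_one_of_mem_domain_top (hx : x ∈ domain d ⊤) : x < 1 := by
  have h := (natEquivParts d).summable_iff.2 hx.2
  have h2 : Summable fun j : ℕ => x ^ j := by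
    rw [← summable_nat_add_iff (d + 1)]; exact h
  have := summable_geometric_iff_norm_lt_one.1 h2
  rw [Real.norm_eq_abs] at this
  exact (abs_lt.1 this).2

lemma mem_domain_of_lt_one (h0 : 0 < x) (h1 : x < 1) : x ∈ domain d k :=
  ⟨h0, (summable_geometric_of_lt_one h0.le h1).comp_injective Subtype.val_injective⟩

lemma mem_domain_coe {K : ℕ} (h0 : 0 < x) : x ∈ domain d (K : ℕ∞) := ⟨h0, .of_finite⟩

lemma summable_pow_mul (hx : x ∈ domain d k) (r : ℕ) :
    Summable fun i : parts d k => ((i : ℕ) : ℝ) ^ r * x ^ (i : ℕ) := by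
  induction k using ENat.recTopCoe with
  | top =>
    have h : ‖x‖ < 1 := by
      rw [Real.norm_eq_abs, abs_of_pos hx.1]; exact lt_one_of_mem_domain_top hx
    exact (summable_pow_mul_geometric_of_norm_lt_one r h).comp_injective Subtype.val_injective
  | coe K => exact .of_finite

lemma summable_coe_mul (hx : x ∈ domain d k) :
    Summable fun i : parts d k => ((i : ℕ) : ℝ) * x ^ (i : ℕ) := by
  simpa using summable_pow_mul hx 1

lemma hasSum_genSum (hx : x ∈ domain d k) :
    HasSum (fun i : parts d k => x ^ (i : ℕ)) (genSum d k x) := hx.2.hasSum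

lemma pow_lt_genSum (hdk : (d : ℕ∞) < k) (hx : x ∈ domain d k) (i : parts d k) :
    x ^ (i : ℕ) < genSum d k x := by
  obtain ⟨j, hj⟩ : ∃ j : parts d k, j ≠ i := by
    by_cases h : (i : ℕ) = d + 1
    · exact ⟨⟨_, second_mem_parts hdk⟩, fun h' => by rw [← h'] at h; simp at h⟩
    · exact ⟨⟨_, first_mem_parts hdk⟩, fun h' => h (by rw [← h'])⟩
  have h := hx.2.sum_le_tsum {i, j} (fun l _ => (pow_pos hx.1 _).le)
  rw [Finset.sum_pair hj.symm] at h
  have := pow_pos hx.1 (j : ℕ)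
  unfold genSum
  linarith

lemma genSum_pos (hdk : (d : ℕ∞) < k) (hx : x ∈ domain d k) : 0 < genSum d k x :=
  (pow_pos hx.1 _).trans (pow_lt_genSum hdk hx ⟨_, first_mem_parts hdk⟩)

lemma wMin_coe (K : ℕ) : wMin (K : ℕ∞) = 1 / ((K : ℝ) + 1) := by simp [wMin]

lemma wMin_top : wMin ⊤ = 0 := by simp [wMin]

lemma wMin_nonneg (k : ℕ∞) : 0 ≤ wMin k := by
  unfold wMin; split_ifs
  · exact le_rfl
  · positivity

lemma wMax_pos (d : ℕ) : 0 < wMax d := by unfold wMax; positivity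

/-! ### Uniqueness of ρ_w by minimality -/

/-- For k = ∞ and x ≥ 1 the terms (wi - 1)x^i would eventually be at least 1, so the series could
not converge. -/
lemma mem_domain_of_isRhoW (hw : 0 < w) (hx : IsRhoW d k w x) : x ∈ domain d k := by
  induction k using ENat.recTopCoe with
  | coe K => exact mem_domain_coe hx.1
  | top =>
    refine mem_domain_of_lt_one hx.1 ?_
    by_contra! h1
    have h := ((natEquivParts d).summable_iff.2 hx.2.summable).tendsto_atTop_zero
    obtain ⟨j, hj⟩ := exists_nat_gt (2 / w)
    rw [div_lt_iff₀ hw] at hj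
    obtain ⟨n, hn, hnj⟩ := ((h.eventually (gt_mem_nhds one_pos)).and (eventually_ge_atTop j)).exists
    simp only [Function.comp_apply, natEquivParts_coe] at hn
    have h2 : 1 ≤ x ^ (n + (d + 1)) := one_le_pow₀ h1
    have h3 : (j : ℝ) ≤ n := by exact_mod_cast hnj
    have h4 : (1 : ℝ) ≤ w * ((n + (d + 1) : ℕ) : ℝ) - 1 := by
      push_cast
      nlinarith [Nat.cast_nonneg (α := ℝ) d]
    nlinarith

/-- Put y = x e^l. Then y^i e^(-l/w) = x^i e^(l(i - 1/w)) ≥ x^i (1 + l(i - 1/w)), and on summation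
the linear term vanishes by the equation for x. Taking logarithms gives the claim. The inequality is
strict at some i because d+1 and d+2 cannot both equal 1/w. -/
lemma expo_lt_of_isRhoW (hdk : (d : ℕ∞) < k) (hw : 0 < w) (hx : IsRhoW d k w x)
    (hy : y ∈ domain d k) (hne : y ≠ x) : expo d k w x < expo d k w y := by
  have hxd := mem_domain_of_isRhoW hw hx
  have hx0 := hx.1
  have hy0 := hy.1
  have hz : 0 < y / x := by positivity
  set l := Real.log (y / x) with hl
  have hl0 : l ≠ 0 := by
    rw [hl]; intro h
    have := Real.eq_one_of_pos_of_log_eq_zero hz h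
    rw [div_eq_one_iff_eq hx0.ne'] at this
    exact hne this
  have hyi : ∀ i : ℕ, y ^ i * Real.exp (-(l / w)) = x ^ i * Real.exp (l * (i - 1 / w)) := by
    intro i
    have : y ^ i = x ^ i * Real.exp (l * i) := by
      rw [mul_comm l, Real.exp_nat_mul, hl, Real.exp_log hz, ← mul_pow]
      congr 1; field_simp
    rw [this, mul_assoc, ← Real.exp_add]
    congr 2; ring
  have h1 : HasSum (fun i : parts d k => x ^ (i : ℕ) * (l * ((i : ℕ) - 1 / w) + 1))
      (genSum d k x) := by
    have := (hx.2.mul_left (l / w)).add (hasSum_genSum hxd)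
    rw [mul_zero, zero_add] at this
    refine hasSum_of_forall_eq (fun i => ?_) this
    field_simp
  have h2 : HasSum (fun i : parts d k => x ^ (i : ℕ) * Real.exp (l * ((i : ℕ) - 1 / w)))
      (genSum d k y * Real.exp (-(l / w))) := by
    simpa only [hyi] using (hasSum_genSum hy).mul_right (Real.exp (-(l / w)))
  obtain ⟨i, hi⟩ : ∃ i : parts d k, ((i : ℕ) : ℝ) - 1 / w ≠ 0 := by
    by_contra! h
    have a := h ⟨_, first_mem_parts hdk⟩
    have b := h ⟨_, second_mem_parts hdk⟩
    push_cast at a b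
    linarith
  have h3 : genSum d k x < genSum d k y * Real.exp (-(l / w)) := by
    refine hasSum_lt (i := i) (fun j => ?_) ?_ h1 h2
    · exact mul_le_mul_of_nonneg_left (Real.add_one_le_exp _) (pow_pos hx0 _).le
    · exact mul_lt_mul_of_pos_left (Real.add_one_lt_exp (mul_ne_zero hl0 hi)) (pow_pos hx0 _)
  have h4 := Real.log_lt_log (genSum_pos hdk hxd) h3
  rw [Real.log_mul (genSum_pos hdk hy).ne' (Real.exp_pos _).ne', Real.log_exp] at h4
  have h5 : l = Real.log y - Real.log x := Real.log_div hy0.ne' hx0.ne'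
  have h6 := mul_lt_mul_of_pos_left h4 hw
  have h7 : w * (Real.log (genSum d k y) + -(l / w)) = w * Real.log (genSum d k y) - l := by
    field_simp; ring
  unfold expo
  linarith

lemma isRhoW_unique (hdk : (d : ℕ∞) < k) (hw : 0 < w) (hx : IsRhoW d k w x)
    (hy : IsRhoW d k w y) : y = x := by
  by_contra h
  exact lt_asymm (expo_lt_of_isRhoW hdk hw hx (mem_domain_of_isRhoW hw hy) h)
    (expo_lt_of_isRhoW hdk hw hy (mem_domain_of_isRhoW hw hx) (Ne.symm h))

/-! ### Existence of ρ_w and ρ -/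

lemma exists_isRhoW_top (hw : w ∈ Ioo (wMin ⊤) (wMax d)) : ∃ x, IsRhoW d ⊤ w x := by
  rw [wMin_top, wMax] at hw
  obtain ⟨h0, h1⟩ := hw
  rw [lt_div_iff₀ (by positivity)] at h1
  have h2 : 0 < 1 - w * d := by linarith
  -- After division by x^(d+1) the series sums to wx/(1-x)^2 + (w(d+1)-1)/(1-x); this is its zero.
  refine ⟨(1 - w * (d + 1)) / (1 - w * d), div_pos (by linarith) h2, ?_⟩
  set x := (1 - w * (d + 1)) / (1 - w * d) with hx
  have hx0 : 0 < x := div_pos (by linarith) h2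
  have h1x : 1 - x = w / (1 - w * d) := by rw [hx]; field_simp; ring
  have hx1 : x < 1 := by have : 0 < w / (1 - w * d) := by positivity
                         linarith
  have hn : ‖x‖ < 1 := by rw [Real.norm_eq_abs, abs_of_pos hx0]; exact hx1
  rw [← (natEquivParts d).hasSum_iff]
  have h := (((hasSum_coe_mul_geometric_of_norm_lt_one hn).mul_left w).add
    ((hasSum_geometric_of_norm_lt_one hn).mul_left (w * (d + 1) - 1))).mul_left (x ^ (d + 1))
  have e : x ^ (d + 1) * (w * (x / (1 - x) ^ 2) + (w * (d + 1) - 1) * (1 - x)⁻¹) = 0 := by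
    rw [mul_eq_zero]
    right
    rw [h1x, hx]
    field_simp
    ring
  rw [e] at h
  refine hasSum_of_forall_eq (fun j => ?_) h
  simp only [Function.comp_apply, natEquivParts_coe]
  push_cast
  ring

/-- The substitution x = t/(1-t) maps (0,1) onto the positive reals. Clearing x^(d+1) and the
denominators leaves a polynomial H whose end values w(d+1) - 1 and w(K+1) - 1 have opposite signs.
-/
lemma exists_isRhoW_coe {K : ℕ} (hw : w ∈ Ioo (wMin (K : ℕ∞)) (wMax d)) :
    ∃ x, IsRhoW d (K : ℕ∞) w x := by
  have hdK : d < K := by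
    have := hw.1.trans hw.2
    rw [wMin_coe, wMax, one_div_lt_one_div (by positivity) (by positivity)] at this
    have : (d : ℝ) < K := by linarith
    exact_mod_cast this
  have := Fintype.ofFinite (parts d (K : ℕ∞))
  let H : ℝ → ℝ := fun t => ∑ i : parts d (K : ℕ∞),
    (w * (i : ℕ) - 1) * (t ^ ((i : ℕ) - (d + 1)) * (1 - t) ^ (K + 1 - (i : ℕ)))
  have hc : Continuous H := by fun_prop
  rw [wMin_coe, wMax] at hw
  obtain ⟨h0, h1⟩ := hw
  rw [div_lt_iff₀ (by positivity)] at h0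
  rw [lt_div_iff₀ (by positivity)] at h1
  have hH0 : H 0 < 0 := by
    have : H 0 = w * (d + 1) - 1 := by
      simp only [H]
      rw [Finset.sum_eq_single ⟨d + 1, mem_parts_coe.2 (by omega)⟩]
      · simp
      · intro i _ hi
        have : (i : ℕ) ≠ d + 1 := fun h => hi (Subtype.ext h)
        have := (mem_parts_coe.1 i.2).1
        rw [zero_pow (by omega)]; simp
      · simp
    linarith
  have hH1 : 0 < H 1 := by
    have : H 1 = w * (K + 1) - 1 := by
      simp only [H]
      rw [Finset.sum_eq_single ⟨K + 1, mem_parts_coe.2 (by omega)⟩]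
      · simp
      · intro i _ hi
        have : (i : ℕ) ≠ K + 1 := fun h => hi (Subtype.ext h)
        have := (mem_parts_coe.1 i.2).2
        rw [sub_self, zero_pow (by omega : K + 1 - (i : ℕ) ≠ 0)]; simp
      · simp
    linarith
  obtain ⟨t, ⟨ht0, ht1⟩, ht⟩ := intermediate_value_Ioo zero_le_one hc.continuousOn ⟨hH0, hH1⟩
  have ht2 : 0 < 1 - t := by linarith
  refine ⟨t / (1 - t), by positivity, ?_⟩
  have h2 : HasSum (fun i : parts d (K : ℕ∞) => (w * ((i : ℕ) : ℝ) - 1) *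
      (t ^ ((i : ℕ) - (d + 1)) * (1 - t) ^ (K + 1 - (i : ℕ)))) 0 := by
    rw [← ht]; exact hasSum_fintype _
  have h3 := h2.mul_left (t ^ (d + 1) / (1 - t) ^ (K + 1))
  rw [mul_zero] at h3
  refine hasSum_of_forall_eq (fun i => ?_) h3
  obtain ⟨ha, hb⟩ := mem_parts_coe.1 i.2
  have e1 : t ^ (i : ℕ) = t ^ (d + 1) * t ^ ((i : ℕ) - (d + 1)) := by
    rw [← pow_add]; congr 1; omega
  have e2 : (1 - t) ^ (K + 1) = (1 - t) ^ (i : ℕ) * (1 - t) ^ (K + 1 - (i : ℕ)) := by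
    rw [← pow_add]; congr 1; omega
  rw [div_pow, e1, e2]
  field_simp

lemma exists_isRhoW (hw : w ∈ Ioo (wMin k) (wMax d)) : ∃ x, IsRhoW d k w x := by
  induction k using ENat.recTopCoe with
  | top => exact exists_isRhoW_top hw
  | coe K => exact exists_isRhoW_coe hw

lemma isRhoW_rhoW (hw : w ∈ Ioo (wMin k) (wMax d)) : IsRhoW d k w (rhoW d k w) :=
  Classical.epsilon_spec (exists_isRhoW hw)

lemma isRho_mem_domain (hx : IsRho d k x) : x ∈ domain d k := ⟨hx.1, hx.2.summable⟩

lemma isRho_unique (hdk : (d : ℕ∞) < k) (hx : IsRho d k x) (hy : IsRho d k y) : y = x := by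
  have key : ∀ {a b : ℝ}, IsRho d k a → IsRho d k b → ¬ a < b := by
    intro a b ha hb hab
    refine lt_irrefl (1 : ℝ) (hasSum_lt (i := ⟨_, first_mem_parts hdk⟩) (fun i => ?_) ?_ ha.2 hb.2)
    · exact pow_le_pow_left₀ ha.1.le hab.le _
    · exact pow_lt_pow_left₀ hab ha.1.le (by simp)
  exact le_antisymm (not_lt.1 (key hx hy)) (not_lt.1 (key hy hx))

lemma exists_isRho (hdk : (d : ℕ∞) < k) : ∃ x, IsRho d k x := by
  induction k using ENat.recTopCoe with
  | top =>
    -- The geometric series turns the equation into t^(d+1) = 1 - t.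
    have hc : Continuous fun t : ℝ => t ^ (d + 1) + t := by fun_prop
    obtain ⟨t, ⟨ht0, ht1⟩, ht⟩ := intermediate_value_Ioo zero_le_one hc.continuousOn
      (show (1 : ℝ) ∈ Ioo _ _ by constructor <;> norm_num)
    refine ⟨t, ht0, ?_⟩
    rw [← (natEquivParts d).hasSum_iff]
    have h := (hasSum_geometric_of_lt_one ht0.le ht1).mul_left (t ^ (d + 1))
    have e : t ^ (d + 1) * (1 - t)⁻¹ = 1 := by
      have : (1 - t) ≠ 0 := by linarith
      simp only at ht
      field_simp
      linarith
    rw [e] at h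
    refine hasSum_of_forall_eq (fun j => ?_) h
    simp only [Function.comp_apply, natEquivParts_coe]
    ring
  | coe K =>
    have := Fintype.ofFinite (parts d (K : ℕ∞))
    have hc : Continuous fun t : ℝ => ∑ i : parts d (K : ℕ∞), t ^ (i : ℕ) := by fun_prop
    have h0 : ∑ i : parts d (K : ℕ∞), (0 : ℝ) ^ (i : ℕ) = 0 :=
      Finset.sum_eq_zero fun i _ => zero_pow (by have := (mem_parts_coe.1 i.2).1; omega)
    have h1 : 1 < ∑ i : parts d (K : ℕ∞), (1 : ℝ) ^ (i : ℕ) := by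
      have := pow_lt_genSum hdk (mem_domain_coe one_pos) ⟨_, first_mem_parts hdk⟩
      rwa [genSum, tsum_fintype, one_pow] at this
    obtain ⟨t, ⟨ht0, ht1⟩, ht⟩ := intermediate_value_Ioo zero_le_one hc.continuousOn
      (show (1 : ℝ) ∈ Ioo _ _ from ⟨by simp only [h0]; norm_num, h1⟩)
    exact ⟨t, ht0, ht ▸ hasSum_fintype _⟩

lemma isRho_rho (hdk : (d : ℕ∞) < k) : IsRho d k (rho d k) :=
  Classical.epsilon_spec (exists_isRho hdk)

/-! ### σ as a minimum of exponents -/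

lemma rpow_sub_eq (hx : 0 < x) (i : ℕ) : x ^ ((i : ℝ) - 1 / w) = x ^ i * x ^ (-(1 / w)) := by
  rw [sub_eq_add_neg, Real.rpow_add hx, Real.rpow_natCast]

lemma summable_rpow_sub (hx : x ∈ domain d k) :
    Summable fun i : parts d k => x ^ (((i : ℕ) : ℝ) - 1 / w) := by
  simp only [rpow_sub_eq hx.1]
  exact hx.2.mul_right _

lemma sigma_eq_expo (hdk : (d : ℕ∞) < k) (hw : w ∈ Ioo (wMin k) (wMax d)) (hx : IsRhoW d k w x) :
    sigma d k w = expo d k w x / Real.log 2 := by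
  have hw0 : 0 < w := (wMin_nonneg k).trans_lt hw.1
  have hxe : rhoW d k w = x := isRhoW_unique hdk hw0 hx (isRhoW_rhoW hw)
  have hxd := mem_domain_of_isRhoW hw0 hx
  rw [sigma, if_pos hw, hxe]
  simp only [rpow_sub_eq hxd.1]
  rw [tsum_mul_right, ← genSum, Real.logb,
    Real.log_mul (genSum_pos hdk hxd).ne' (Real.rpow_pos_of_pos hxd.1 _).ne',
    Real.log_rpow hxd.1, expo]
  field_simp
  ring

lemma sigma_of_notMem (hw : w ∉ Ioo (wMin k) (wMax d)) : sigma d k w = 0 := by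
  rw [sigma, if_neg hw]

/-- Since g(x) exceeds each of its terms, it is enough to find a part i with wi log x ≥ log x: the
smallest part if x ≤ 1, the largest if x ≥ 1. If w = 0, then k = ∞ and the exponent is -log x with x
< 1. -/
lemma expo_pos (hdk : (d : ℕ∞) < k) (hw : w ∈ Icc (wMin k) (wMax d)) (hx : x ∈ domain d k) :
    0 < expo d k w x := by
  have key : ∀ i : parts d k, 0 < w → Real.log x ≤ w * ((i : ℕ) * Real.log x) →
      0 < expo d k w x := by
    intro i hw0 hi
    have := Real.log_lt_log (pow_pos hx.1 _) (pow_lt_genSum hdk hx i)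
    rw [Real.log_pow] at this
    have := mul_lt_mul_of_pos_left this hw0
    unfold expo
    linarith
  have hwd : w * (d + 1) ≤ 1 := by
    have := hw.2
    rwa [wMax, le_div_iff₀ (by positivity)] at this
  have hsmall : 0 < w → x ≤ 1 → 0 < expo d k w x := by
    intro hw0 hx1
    refine key ⟨_, first_mem_parts hdk⟩ hw0 ?_
    have := Real.log_nonpos hx.1.le hx1
    push_cast
    nlinarith
  induction k using ENat.recTopCoe with
  | top =>
    have hx1 := lt_one_of_mem_domain_top hx
    rcases (show 0 ≤ w by simpa [wMin_top] using hw.1).eq_or_lt with h | h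
    · rw [expo, ← h]
      have := Real.log_neg hx.1 hx1
      linarith
    · exact hsmall h hx1.le
  | coe K =>
    have hK := hw.1
    rw [wMin_coe] at hK
    have hw0 : 0 < w := lt_of_lt_of_le (by positivity) hK
    rw [div_le_iff₀ (by positivity)] at hK
    rcases le_total x 1 with h | h
    · exact hsmall hw0 h
    · have hd : d < K := by exact_mod_cast hdk
      refine key ⟨K + 1, mem_parts_coe.2 (by omega)⟩ hw0 ?_
      have := Real.log_nonneg h
      push_cast
      nlinarith

lemma sigma_lt_expo (hdk : (d : ℕ∞) < k) (hw : w ∈ Icc (wMin k) (wMax d))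
    (hx : x ∈ domain d k) (h : ¬ IsRhoW d k w x) : sigma d k w < expo d k w x / Real.log 2 := by
  by_cases hw' : w ∈ Ioo (wMin k) (wMax d)
  · have hr := isRhoW_rhoW hw'
    rw [sigma_eq_expo hdk hw' hr]
    have := expo_lt_of_isRhoW hdk ((wMin_nonneg k).trans_lt hw'.1) hr hx
      (fun e => h (e ▸ hr))
    exact div_lt_div_of_pos_right this (Real.log_pos one_lt_two)
  · rw [sigma_of_notMem hw']
    exact div_pos (expo_pos hdk hw hx) (Real.log_pos one_lt_two)

lemma sigma_le_expo (hdk : (d : ℕ∞) < k) (hw : w ∈ Icc (wMin k) (wMax d))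
    (hx : x ∈ domain d k) : sigma d k w ≤ expo d k w x / Real.log 2 := by
  by_cases h : IsRhoW d k w x
  · by_cases hw' : w ∈ Ioo (wMin k) (wMax d)
    · exact (sigma_eq_expo hdk hw' h).le
    · rw [sigma_of_notMem hw']
      exact (div_pos (expo_pos hdk hw hx) (Real.log_pos one_lt_two)).le
  · exact (sigma_lt_expo hdk hw hx h).le

lemma sigma_nonneg (hdk : (d : ℕ∞) < k) (w : ℝ) : 0 ≤ sigma d k w := by
  by_cases hw : w ∈ Ioo (wMin k) (wMax d)
  · have hr := isRhoW_rhoW hw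
    rw [sigma_eq_expo hdk hw hr]
    exact (div_pos (expo_pos hdk (Ioo_subset_Icc_self hw)
      (mem_domain_of_isRhoW ((wMin_nonneg k).trans_lt hw.1) hr)) (Real.log_pos one_lt_two)).le
  · rw [sigma_of_notMem hw]

/-! ### Strict concavity -/

/-- The difference of the two equations is (w - v) ∑ i x^i = 0, with a positive sum. -/
lemma eq_of_isRhoW_of_isRhoW (hdk : (d : ℕ∞) < k) {v : ℝ} (hw : 0 < w)
    (h1 : IsRhoW d k w x) (h2 : IsRhoW d k v x) : v = w := by
  have hx := mem_domain_of_isRhoW hw h1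
  have h := h1.2.sub h2.2
  have hs := ((summable_coe_mul hx).hasSum.mul_left (w - v))
  have e : (w - v) * ∑' i : parts d k, ((i : ℕ) : ℝ) * x ^ (i : ℕ) = 0 - 0 := by
    refine hs.unique ?_
    refine hasSum_of_forall_eq (fun i => ?_) h
    ring
  have hpos : 0 < ∑' i : parts d k, ((i : ℕ) : ℝ) * x ^ (i : ℕ) :=
    (summable_coe_mul hx).tsum_pos (fun i => mul_nonneg (Nat.cast_nonneg _) (pow_pos hx.1 _).le)
      ⟨_, first_mem_parts hdk⟩ (mul_pos (by positivity) (pow_pos hx.1 _))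
  rw [sub_zero, mul_eq_zero] at e
  rcases e with e | e
  · linarith
  · exact absurd e hpos.ne'

/-- For fixed x the exponent is affine in w. With x the minimizer at the intermediate point, it
equals σ there and lies strictly above σ at u and v, for which x is not a solution. -/
theorem strictConcaveOn_sigma (hdk : (d : ℕ∞) < k) :
    StrictConcaveOn ℝ (Icc (wMin k) (wMax d)) (sigma d k) := by
  refine ⟨convex_Icc _ _, ?_⟩
  intro u hu v hv huv a b ha hb hab
  set w := a • u + b • v with hw
  have hlt : ∀ u v a b : ℝ, u ∈ Icc (wMin k) (wMax d) → v ∈ Icc (wMin k) (wMax d) → u < v →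
      0 < a → 0 < b → a + b = 1 → a * u + b * v ∈ Ioo (wMin k) (wMax d) ∧ u < a * u + b * v ∧
        a * u + b * v < v := by
    intro u v a b hu hv huv ha hb hab
    have ha' : a = 1 - b := by linarith
    have h1 : u < a * u + b * v := by
      have := mul_pos hb (sub_pos.2 huv)
      rw [ha']; linarith
    have h2 : a * u + b * v < v := by
      have := mul_pos ha (sub_pos.2 huv)
      rw [ha'] at this ⊢; linarith
    exact ⟨⟨hu.1.trans_lt h1, h2.trans_le hv.2⟩, h1, h2⟩
  obtain ⟨hwI, hwu, hwv⟩ : w ∈ Ioo (wMin k) (wMax d) ∧ w ≠ u ∧ w ≠ v := by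
    rw [hw, smul_eq_mul, smul_eq_mul]
    rcases lt_or_gt_of_ne huv with h | h
    · obtain ⟨h1, h2, h3⟩ := hlt u v a b hu hv h ha hb hab
      exact ⟨h1, h2.ne', h3.ne⟩
    · obtain ⟨h1, h2, h3⟩ := hlt v u b a hv hu h hb ha (by linarith)
      rw [add_comm]
      exact ⟨h1, h3.ne, h2.ne'⟩
  have hw0 : 0 < w := (wMin_nonneg k).trans_lt hwI.1
  have hr := isRhoW_rhoW hwI
  have hd := mem_domain_of_isRhoW hw0 hr
  have e1 := sigma_lt_expo hdk hu hd
    (fun h => hwu (eq_of_isRhoW_of_isRhoW hdk hw0 hr h).symm)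
  have e2 := sigma_lt_expo hdk hv hd
    (fun h => hwv (eq_of_isRhoW_of_isRhoW hdk hw0 hr h).symm)
  rw [sigma_eq_expo hdk hwI hr]
  have e3 : expo d k w (rhoW d k w) / Real.log 2 = a * (expo d k u (rhoW d k w) / Real.log 2) +
      b * (expo d k v (rhoW d k w) / Real.log 2) := by
    have hb' : b = 1 - a := by linarith
    simp only [expo]
    generalize Real.log (rhoW d k w) = r
    generalize Real.log (genSum d k (rhoW d k w)) = s
    rw [hw, hb', smul_eq_mul, smul_eq_mul]
    ring
  rw [e3, smul_eq_mul, smul_eq_mul]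
  exact add_lt_add (mul_lt_mul_of_pos_left e1 ha) (mul_lt_mul_of_pos_left e2 hb)

/-! ### Behaviour at the endpoints and continuity -/

lemma genSum_le_of_lt_one (h0 : 0 < x) (h1 : x < 1) :
    genSum d k x ≤ x ^ (d + 1) / (1 - x) := by
  have hs : HasSum (fun i : parts d ⊤ => x ^ (i : ℕ)) (x ^ (d + 1) / (1 - x)) := by
    rw [← (natEquivParts d).hasSum_iff, div_eq_mul_inv]
    refine hasSum_of_forall_eq (fun j => ?_)
      ((hasSum_geometric_of_lt_one h0.le h1).mul_left (x ^ (d + 1)))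
    simp only [Function.comp_apply, natEquivParts_coe]
    ring
  have hsub : parts d k ⊆ parts d ⊤ := fun i hi => mem_parts_top.2 hi.1
  exact hasSum_le_inj (Set.inclusion hsub) (Set.inclusion_injective hsub)
    (fun i _ => (pow_pos h0 _).le) (fun i => by rw [Set.coe_inclusion hsub])
    (hasSum_genSum (mem_domain_of_lt_one h0 h1)) hs

/-- The regime x → 0, where g(x) is close to x^(d+1) and w(d+1) = 1 cancels log x. With 1 - x =
e^(-ε/2) the geometric bound leaves at most wε/2. -/
lemma exists_expo_wMax_lt (hdk : (d : ℕ∞) < k) {ε : ℝ} (hε : 0 < ε) :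
    ∃ x ∈ domain d k, expo d k (wMax d) x < ε := by
  have he : Real.exp (-(ε / 2)) < 1 := by rw [Real.exp_lt_one_iff]; linarith
  have h0 : 0 < 1 - Real.exp (-(ε / 2)) := by linarith
  have h1 : 1 - Real.exp (-(ε / 2)) < 1 := by have := Real.exp_pos (-(ε / 2)); linarith
  refine ⟨_, mem_domain_of_lt_one h0 h1, ?_⟩
  set x := 1 - Real.exp (-(ε / 2)) with hx
  have hd := mem_domain_of_lt_one (d := d) (k := k) h0 h1
  have h2 := Real.log_le_log (genSum_pos hdk hd) (genSum_le_of_lt_one (d := d) (k := k) h0 h1)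
  have h3 : 1 - x = Real.exp (-(ε / 2)) := by rw [hx]; ring
  rw [h3, Real.log_div (pow_pos h0 _).ne' (Real.exp_pos _).ne', Real.log_exp, Real.log_pow] at h2
  push_cast at h2
  have h4 := mul_le_mul_of_nonneg_left h2 (wMax_pos d).le
  have h5 : wMax d * ((d + 1) * Real.log x - -(ε / 2)) = Real.log x + wMax d * (ε / 2) := by
    unfold wMax; field_simp; ring
  have h6 : wMax d ≤ 1 := by
    unfold wMax
    rw [div_le_one (by positivity)]
    have := Nat.cast_nonneg (α := ℝ) d
    linarith
  unfold expo
  nlinarith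

/-- For k = ∞ the exponent at w = 0 is -log x, and x → 1. For finite k the regime is x → ∞: with t =
1/x, F(t) = g(x) x^(-(K+1)) tends to 1, and the exponent is log F(t)/(K+1). -/
lemma exists_expo_wMin_lt (hdk : (d : ℕ∞) < k) {ε : ℝ} (hε : 0 < ε) :
    ∃ x ∈ domain d k, expo d k (wMin k) x < ε := by
  induction k using ENat.recTopCoe with
  | top =>
    refine ⟨Real.exp (-(ε / 2)), mem_domain_of_lt_one (Real.exp_pos _) ?_, ?_⟩
    · rw [Real.exp_lt_one_iff]; linarith
    · rw [expo, wMin_top, Real.log_exp]; linarith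
  | coe K =>
    have hdK : d < K := by exact_mod_cast hdk
    have := Fintype.ofFinite (parts d (K : ℕ∞))
    let F : ℝ → ℝ := fun t => ∑ i : parts d (K : ℕ∞), t ^ (K + 1 - (i : ℕ))
    have hc : Continuous F := by fun_prop
    have hF0 : F 0 = 1 := by
      simp only [F]
      rw [Finset.sum_eq_single ⟨K + 1, mem_parts_coe.2 (by omega)⟩]
      · simp
      · intro i _ hi
        have : (i : ℕ) ≠ K + 1 := fun h => hi (Subtype.ext h)
        have := (mem_parts_coe.1 i.2).2
        exact zero_pow (by omega)
      · simp
    have h1 : 1 < Real.exp ε := Real.one_lt_exp_iff.2 hε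
    have h2 : ∀ᶠ t in 𝓝[>] (0 : ℝ), F t < Real.exp ε :=
      (hc.tendsto' 0 1 hF0 |>.eventually (gt_mem_nhds h1)).filter_mono nhdsWithin_le_nhds
    obtain ⟨t, ht, ht0⟩ := (h2.and self_mem_nhdsWithin).exists
    have ht0 : 0 < t := ht0
    have hd : t⁻¹ ∈ domain d (K : ℕ∞) := mem_domain_coe (inv_pos.2 ht0)
    refine ⟨t⁻¹, hd, ?_⟩
    have hg : F t = genSum d K t⁻¹ * t ^ (K + 1) := by
      rw [genSum, tsum_fintype, Finset.sum_mul]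
      refine Finset.sum_congr rfl fun i _ => ?_
      rw [pow_sub₀ _ ht0.ne' (mem_parts_coe.1 i.2).2, inv_pow, mul_comm]
    have hFt : 0 < F t := by rw [hg]; exact mul_pos (genSum_pos hdk hd) (pow_pos ht0 _)
    have h3 := Real.log_lt_log hFt ht
    rw [Real.log_exp, hg, Real.log_mul (genSum_pos hdk hd).ne' (pow_pos ht0 _).ne',
      Real.log_pow] at h3
    push_cast at h3
    have h4 : (0 : ℝ) < K + 1 := by positivity
    have h5 : expo d K (wMin K) t⁻¹ =
        (Real.log (genSum d K t⁻¹) + (K + 1) * Real.log t) / (K + 1) := by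
      rw [expo, wMin_coe, Real.log_inv]
      field_simp
      ring
    rw [h5, div_lt_iff₀ h4]
    nlinarith [Nat.cast_nonneg (α := ℝ) K]

lemma exists_expo_lt_of_notMem_Ioo (hdk : (d : ℕ∞) < k) (hw : w ∈ Icc (wMin k) (wMax d))
    (hw' : w ∉ Ioo (wMin k) (wMax d)) {ε : ℝ} (hε : 0 < ε) :
    ∃ x ∈ domain d k, expo d k w x < ε := by
  rcases hw.1.eq_or_lt with h | h
  · rw [← h]; exact exists_expo_wMin_lt hdk hε
  · rcases hw.2.eq_or_lt with h' | h'
    · rw [h']; exact exists_expo_wMax_lt hdk hε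
    · exact absurd ⟨h, h'⟩ hw'

/-- Concavity gives continuity in the interior. At an endpoint σ is squeezed between 0 and an
exponent with fixed x that is small there and continuous in w. -/
theorem continuousOn_sigma (hdk : (d : ℕ∞) < k) :
    ContinuousOn (sigma d k) (Icc (wMin k) (wMax d)) := by
  intro w hw
  by_cases hw' : w ∈ Ioo (wMin k) (wMax d)
  · have hc := ((strictConcaveOn_sigma hdk).concaveOn.subset Ioo_subset_Icc_self
      (convex_Ioo _ _)).continuousOn isOpen_Ioo
    exact (hc.continuousAt (isOpen_Ioo.mem_nhds hw')).continuousWithinAt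
  · rw [ContinuousWithinAt, sigma_of_notMem hw', tendsto_order]
    refine ⟨fun a ha => Eventually.of_forall fun v => ha.trans_le (sigma_nonneg hdk v),
      fun a ha => ?_⟩
    have hl := Real.log_pos one_lt_two
    obtain ⟨x, hx, hlt⟩ := exists_expo_lt_of_notMem_Ioo hdk hw hw' (mul_pos ha hl)
    have hc : Continuous fun v => expo d k v x := by unfold expo; fun_prop
    filter_upwards [self_mem_nhdsWithin,
      (hc.continuousAt.eventually (gt_mem_nhds hlt)).filter_mono nhdsWithin_le_nhds] with v hv hv2
    exact (sigma_le_expo hdk hv hx).trans_lt ((div_lt_iff₀ hl).2 hv2)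

/-! ### The maximum of σ -/

lemma hasSum_wStar (hdk : (d : ℕ∞) < k) : HasSum
    (fun i : parts d k => ((i : ℕ) : ℝ) * rho d k ^ (i : ℕ)) (wStar d k)⁻¹ := by
  rw [wStar, inv_inv]
  exact (summable_coe_mul (isRho_mem_domain (isRho_rho hdk))).hasSum

/-- The ρ^i are probability weights on the parts, and 1/w* is their mean; it exceeds the smallest
part because d+2 also has positive weight. -/
lemma lt_wStar_inv (hdk : (d : ℕ∞) < k) : (d : ℝ) + 1 < (wStar d k)⁻¹ := by
  have hr := isRho_rho hdk
  have h := hr.2.mul_left ((d : ℝ) + 1)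
  rw [mul_one] at h
  refine hasSum_lt (i := ⟨_, second_mem_parts hdk⟩) (fun i => ?_) ?_ h (hasSum_wStar hdk)
  · have : (d : ℝ) + 1 ≤ (i : ℕ) := by exact_mod_cast i.2.1
    exact mul_le_mul_of_nonneg_right this (pow_pos hr.1 _).le
  · exact mul_lt_mul_of_pos_right (by push_cast; linarith) (pow_pos hr.1 _)

theorem wStar_mem_Ioo (hdk : (d : ℕ∞) < k) : wStar d k ∈ Ioo (wMin k) (wMax d) := by
  have h1 := lt_wStar_inv hdk
  have hd : (0 : ℝ) < d + 1 := by positivity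
  have h0 : 0 < wStar d k := inv_pos.1 (hd.trans h1)
  refine ⟨?_, ?_⟩
  · induction k using ENat.recTopCoe with
    | top => rwa [wMin_top]
    | coe K =>
      have hr := isRho_rho hdk
      have h := hr.2.mul_left ((K : ℝ) + 1)
      rw [mul_one] at h
      have h2 : (wStar d K)⁻¹ < K + 1 := by
        refine hasSum_lt (i := ⟨_, first_mem_parts hdk⟩) (fun i => ?_) ?_ (hasSum_wStar hdk) h
        · have : ((i : ℕ) : ℝ) ≤ K + 1 := by exact_mod_cast (mem_parts_coe.1 i.2).2
          exact mul_le_mul_of_nonneg_right this (pow_pos hr.1 _).le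
        · have : (d : ℝ) < K := by exact_mod_cast hdk
          exact mul_lt_mul_of_pos_right (by push_cast; linarith) (pow_pos hr.1 _)
      rw [wMin_coe, one_div]
      exact inv_lt_of_inv_lt₀ h0 h2
  · rw [wMax, one_div]
    exact (lt_inv_comm₀ hd h0).1 h1

lemma isRhoW_wStar (hdk : (d : ℕ∞) < k) : IsRhoW d k (wStar d k) (rho d k) := by
  have hr := isRho_rho hdk
  have h0 : 0 < wStar d k := (wMin_nonneg k).trans_lt (wStar_mem_Ioo hdk).1
  refine ⟨hr.1, ?_⟩
  have h := ((hasSum_wStar hdk).mul_left (wStar d k)).sub hr.2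
  rw [mul_inv_cancel₀ h0.ne', sub_self] at h
  refine hasSum_of_forall_eq (fun i => ?_) h
  ring

/-- As g(ρ) = 1, the exponent at x = ρ does not depend on w, so it bounds σ by the same constant
everywhere. -/
lemma expo_rho (hdk : (d : ℕ∞) < k) (w : ℝ) :
    expo d k w (rho d k) / Real.log 2 = -Real.logb 2 (rho d k) := by
  rw [expo, genSum, (isRho_rho hdk).2.tsum_eq, Real.log_one, Real.logb]
  ring

theorem sigma_wStar (hdk : (d : ℕ∞) < k) : sigma d k (wStar d k) = -Real.logb 2 (rho d k) := by
  rw [sigma_eq_expo hdk (wStar_mem_Ioo hdk) (isRhoW_wStar hdk), expo_rho hdk]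

theorem isMaxOn_sigma_wStar (hdk : (d : ℕ∞) < k) :
    IsMaxOn (sigma d k) (Icc (wMin k) (wMax d)) (wStar d k) := by
  intro w hw
  rw [mem_ofPred_eq, sigma_wStar hdk, ← expo_rho hdk w]
  exact sigma_le_expo hdk hw (isRho_mem_domain (isRho_rho hdk))

/-! ### Unique decomposition of strings into blocks -/

/-- The concatenations of blocks of Hamming weight `W`. -/
def weightStrings (d : ℕ) (k : ℕ∞) (W : ℕ) : Set (List Bool) :=
  {s | s ∈ (blocks d k)∗ ∧ s.count true = W}

/-- The block `0^(i-1) 1` of length `i`. -/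
def block (i : ℕ) : List Bool := List.replicate (i - 1) false ++ [true]

lemma block_mem_blocks (i : parts d k) : block i ∈ blocks d k := by
  have h1 := i.2.1
  refine ⟨i - 1, by omega, ?_, rfl⟩
  have h2 := i.2.2
  induction k using ENat.recTopCoe with
  | top => exact le_top
  | coe K =>
    have := (mem_parts_coe.1 i.2).2
    exact_mod_cast (by omega : (i : ℕ) - 1 ≤ K)

lemma exists_block_eq {b : List Bool} (hb : b ∈ blocks d k) : ∃ i : parts d k, b = block i := by
  obtain ⟨j, h1, h2, rfl⟩ := hb
  exact ⟨⟨j + 1, mem_parts_of_le h2 (by omega) le_rfl⟩, rfl⟩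

lemma length_block (i : parts d k) : (block i).length = i := by
  have h1 := i.2.1
  simp [block]
  omega

lemma count_block (i : ℕ) : (block i).count true = 1 := by
  simp [block, List.count_replicate]

lemma append_mem_kstar {s t : List Bool} (hs : s ∈ (blocks d k)∗) (ht : t ∈ (blocks d k)∗) :
    s ++ t ∈ (blocks d k)∗ := by
  rw [Language.mem_kstar] at *
  obtain ⟨L, rfl, hL⟩ := hs
  obtain ⟨M, rfl, hM⟩ := ht
  refine ⟨L ++ M, by simp, fun y hy => ?_⟩
  rcases List.mem_append.1 hy with h | h
  exacts [hL y h, hM y h]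

lemma mem_kstar_of_mem {s : List Bool} (hs : s ∈ blocks d k) : s ∈ (blocks d k)∗ :=
  Language.mem_kstar.2 ⟨[s], by simp, by simpa using hs⟩

lemma append_mem_weightStrings {s t : List Bool} {W V : ℕ} (hs : s ∈ weightStrings d k W)
    (ht : t ∈ weightStrings d k V) : s ++ t ∈ weightStrings d k (W + V) :=
  ⟨append_mem_kstar hs.1 ht.1, by rw [List.count_append, hs.2, ht.2]⟩

lemma block_mem_weightStrings (i : parts d k) : block i ∈ weightStrings d k 1 :=
  ⟨mem_kstar_of_mem (block_mem_blocks i), count_block i⟩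

/-- Prepending a block to a string. -/
def consBlock (W : ℕ) (p : parts d k × weightStrings d k W) : weightStrings d k (W + 1) :=
  ⟨block p.1 ++ p.2, add_comm 1 W ▸ append_mem_weightStrings (block_mem_weightStrings p.1) p.2.2⟩

/-- Unique decoding: the first 1 of a string marks the end of its first block. -/
lemma replicate_append_true_inj {s t : List Bool} : ∀ {m n : ℕ},
    List.replicate m false ++ true :: s = List.replicate n false ++ true :: t → m = n ∧ s = t
  | 0, 0, h => by simpa using h
  | 0, n + 1, h => by simp [List.replicate_succ] at h
  | m + 1, 0, h => by simp [List.replicate_succ] at h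
  | m + 1, n + 1, h => by
    simp only [List.replicate_succ, List.cons_append, List.cons.injEq, true_and] at h
    obtain ⟨h1, h2⟩ := replicate_append_true_inj h
    exact ⟨by rw [h1], h2⟩

lemma consBlock_bijective (W : ℕ) : Function.Bijective (consBlock (d := d) (k := k) W) := by
  constructor
  · rintro ⟨i, s⟩ ⟨j, t⟩ h
    have h' : block i ++ (s : List Bool) = block j ++ t := congrArg Subtype.val h
    simp only [block, List.append_assoc, List.singleton_append] at h'
    obtain ⟨h1, h2⟩ := replicate_append_true_inj h'
    have := i.2.1
    have := j.2.1
    exact Prod.ext (Subtype.ext (by simp only; omega)) (Subtype.ext h2)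
  · rintro ⟨s, hs, hW⟩
    obtain ⟨L, rfl, hL⟩ := Language.mem_kstar.1 hs
    cases L with
    | nil => simp at hW
    | cons b L =>
      obtain ⟨i, hi⟩ := exists_block_eq (hL b (by simp))
      refine ⟨⟨i, ⟨L.flatten, Language.mem_kstar.2
        ⟨L, rfl, fun y hy => hL y (List.mem_cons_of_mem _ hy)⟩, ?_⟩⟩, Subtype.ext ?_⟩
      · rw [List.flatten_cons, hi, List.count_append, count_block] at hW
        omega
      · simp [consBlock, hi]

lemma mem_weightStrings_zero {s : List Bool} : s ∈ weightStrings d k 0 ↔ s = [] := by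
  constructor
  · rintro ⟨hs, hW⟩
    obtain ⟨L, rfl, hL⟩ := Language.mem_kstar.1 hs
    cases L with
    | nil => rfl
    | cons b L =>
      obtain ⟨i, hi⟩ := exists_block_eq (hL b (by simp))
      rw [List.flatten_cons, hi, List.count_append, count_block] at hW
      omega
  · rintro rfl
    exact ⟨Language.nil_mem_kstar _, rfl⟩

instance : Unique (weightStrings d k 0) where
  default := ⟨[], mem_weightStrings_zero.2 rfl⟩
  uniq s := Subtype.ext (mem_weightStrings_zero.1 s.2)

lemma hasSum_weightStrings_zero (F : ℕ → ℝ) :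
    HasSum (fun s : weightStrings d k 0 => F (s : List Bool).length) (F 0) :=
  hasSum_unique (fun s : weightStrings d k 0 => F (s : List Bool).length)

lemma length_consBlock (W : ℕ) (p : parts d k × weightStrings d k W) :
    (consBlock W p : List Bool).length = p.1 + (p.2 : List Bool).length := by
  simp [consBlock, length_block]

/-- Strings of weight `W + 1` are pairs of a block and a string of weight `W`. -/
def consBlockEquiv (W : ℕ) : parts d k × weightStrings d k W ≃ weightStrings d k (W + 1) :=
  Equiv.ofBijective (consBlock W) (consBlock_bijective W)

/-! ### Generating function and moments of the length -/

lemma hasSum_weightStrings (hx : x ∈ domain d k) (W : ℕ) :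
    HasSum (fun s : weightStrings d k W => x ^ (s : List Bool).length) (genSum d k x ^ W) := by
  induction W with
  | zero => simpa using hasSum_weightStrings_zero (d := d) (k := k) (fun n => x ^ n)
  | succ W ih =>
    rw [← (consBlockEquiv W).hasSum_iff, pow_succ']
    have h := (hasSum_genSum hx).mul ih ((hasSum_genSum hx).summable.mul_of_nonneg ih.summable
      (fun i => (pow_pos hx.1 _).le) (fun s => (pow_pos hx.1 _).le))
    refine hasSum_of_forall_eq (fun p => ?_) h
    simp [consBlockEquiv, length_consBlock, pow_add]

/-- The second moment of the length about its mean: `W` independent blocks, each of mean length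
`μ` under the weights `x^i`. -/
lemma hasSum_weightStrings_sq {μ v : ℝ} (hx : x ∈ domain d k)
    (hμ : HasSum (fun i : parts d k => x ^ (i : ℕ) * ((i : ℕ) - μ)) 0)
    (hv : HasSum (fun i : parts d k => x ^ (i : ℕ) * ((i : ℕ) - μ) ^ 2) v) (W : ℕ) :
    HasSum (fun s : weightStrings d k W => x ^ (s : List Bool).length *
      ((s : List Bool).length - μ * W)) 0 ∧
    HasSum (fun s : weightStrings d k W => x ^ (s : List Bool).length *
      ((s : List Bool).length - μ * W) ^ 2) (W * (v * genSum d k x ^ W / genSum d k x)) := by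
  have hpos : ∀ n : ℕ, 0 ≤ x ^ n := fun n => (pow_pos hx.1 n).le
  induction W with
  | zero =>
    constructor
    · simpa using hasSum_weightStrings_zero (d := d) (k := k) (fun n => x ^ n * n)
    · have h : HasSum (fun s : weightStrings d k 0 => x ^ (s : List Bool).length *
          ((s : List Bool).length : ℝ) ^ 2) (x ^ 0 * ((0 : ℕ) : ℝ) ^ 2) :=
        hasSum_weightStrings_zero (fun n => x ^ n * (n : ℝ) ^ 2)
      rw [show x ^ 0 * ((0 : ℕ) : ℝ) ^ 2 = 0 by simp] at h
      simpa using h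
  | succ W ih =>
    obtain ⟨ih1, ih2⟩ := ih
    have hW := hasSum_weightStrings hx W
    have hg := hasSum_genSum hx
    have prod {f : parts d k → ℝ} {h : weightStrings d k W → ℝ} {a b : ℝ} (hf : HasSum f a)
        (hh : HasSum h b) : HasSum (fun p : _ × _ => f p.1 * h p.2) (a * b) :=
      hf.mul hh (summable_mul_of_summable_norm hf.summable.norm hh.summable.norm)
    constructor
    · rw [← (consBlockEquiv W).hasSum_iff]
      have h := (prod hμ hW).add (prod hg ih1)
      rw [zero_mul, mul_zero, add_zero] at h
      refine hasSum_of_forall_eq (fun p => ?_) h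
      simp only [Function.comp_apply, consBlockEquiv, Equiv.ofBijective_apply, length_consBlock]
      push_cast
      ring
    · rw [← (consBlockEquiv W).hasSum_iff]
      -- The square of a sum of two centred lengths is expanded; the cross term is a product of two
      -- vanishing first moments.
      have h := ((prod hv hW).add ((prod hμ ih1).mul_left 2)).add (prod hg ih2)
      have e : v * genSum d k x ^ W + 2 * (0 * 0) +
          genSum d k x * (W * (v * genSum d k x ^ W / genSum d k x)) =
          ((W + 1 : ℕ) : ℝ) * (v * genSum d k x ^ (W + 1) / genSum d k x) := by
        -- Without d < k there may be no parts at all. Then g = 0 and the quotients are 0 by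
        -- default, while for W = 0 the left side is v, so v = 0 must be shown.
        rcases eq_or_ne (genSum d k x) 0 with h0 | h0
        · have : (fun i : parts d k => x ^ (i : ℕ)) = 0 := by
            rw [h0] at hg
            exact (hasSum_zero_iff_of_nonneg fun i => hpos _).1 hg
          have hv0 : v = 0 := by
            refine hv.unique ?_
            refine hasSum_of_forall_eq (fun i => ?_) hasSum_zero
            have := congrFun this i
            simp only [Pi.zero_apply] at this
            rw [this, zero_mul]
          rw [hv0]; simp
        · push_cast
          field_simp
          ring
      rw [e] at h
      refine hasSum_of_forall_eq (fun p => ?_) h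
      simp only [Function.comp_apply, consBlockEquiv, Equiv.ofBijective_apply, length_consBlock]
      push_cast
      ring

/-! ### Coefficients: bounds, positivity and concentration -/

lemma mem_inputsW {n W : ℕ} {s : List Bool} :
    s ∈ inputsW d k n W ↔ s ∈ weightStrings d k W ∧ s.length = n := by
  simp only [inputsW, inputs, weightStrings, mem_ofPred_eq]
  tauto

lemma finite_inputsW (n W : ℕ) : (inputsW d k n W).Finite :=
  (List.finite_length_eq Bool n).subset fun _ hs => hs.1.1

/-- Grouping a sum over the strings of weight `W` by their lengths. -/
lemma hasSum_S {W : ℕ} {F : ℕ → ℝ} {a : ℝ}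
    (h : HasSum (fun s : weightStrings d k W => F (s : List Bool).length) a) :
    HasSum (fun n => (S d k n W : ℝ) * F n) a := by
  let len : weightStrings d k W → ℕ := fun s => (s : List Bool).length
  rw [← (Equiv.sigmaFiberEquiv len).hasSum_iff] at h
  refine h.sigma fun n => ?_
  let e : {s // len s = n} ≃ inputsW d k n W :=
    { toFun s := ⟨s.1, mem_inputsW.2 ⟨s.1.2, s.2⟩⟩
      invFun s := ⟨⟨s, (mem_inputsW.1 s.2).1⟩, (mem_inputsW.1 s.2).2⟩
      left_inv _ := rfl
      right_inv _ := rfl }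
  have := (finite_inputsW (d := d) (k := k) n W).fintype
  have := Fintype.ofEquiv _ e.symm
  have hc : (Fintype.card {s // len s = n}) = S d k n W := by
    rw [Fintype.card_congr e, S, ← Nat.card_coe_set_eq, Nat.card_eq_fintype_card]
  have h2 := hasSum_fintype (fun _ : {s // len s = n} => F n)
  rw [Finset.sum_const, Finset.card_univ, hc, nsmul_eq_mul] at h2
  refine hasSum_of_forall_eq (fun s => ?_) h2
  exact congrArg F s.2

lemma hasSum_S_pow (hx : x ∈ domain d k) (W : ℕ) :
    HasSum (fun n => (S d k n W : ℝ) * x ^ n) (genSum d k x ^ W) :=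
  hasSum_S (F := fun n => x ^ n) (hasSum_weightStrings hx W)

lemma S_mul_pow_le (hx : x ∈ domain d k) (n W : ℕ) :
    (S d k n W : ℝ) * x ^ n ≤ genSum d k x ^ W :=
  le_hasSum (hasSum_S_pow hx W) n fun _ _ => mul_nonneg (Nat.cast_nonneg _) (pow_pos hx.1 _).le

lemma S_pos_iff {n W : ℕ} : 0 < S d k n W ↔ (inputsW d k n W).Nonempty :=
  Set.ncard_pos (finite_inputsW n W)

/-- Appending one fixed string is injective. This is how lengths get corrected in the lower bound.
-/
lemma S_le_S_add {n m W V : ℕ} (h : 0 < S d k m V) : S d k n W ≤ S d k (n + m) (W + V) := by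
  obtain ⟨t, ht⟩ := S_pos_iff.1 h
  rw [mem_inputsW] at ht
  refine Set.ncard_le_ncard_of_injOn (fun s => s ++ t) (fun s hs => ?_)
    (fun s _ s' _ hss => List.append_cancel_right hss) (finite_inputsW _ _)
  rw [mem_inputsW] at hs ⊢
  exact ⟨append_mem_weightStrings hs.1 ht.1, by rw [List.length_append, hs.2, ht.2]⟩

lemma S_pos {K : ℕ} (hd : d ≤ K) (hK : (K : ℕ∞) ≤ k) {n W : ℕ} (h1 : (d + 1) * W ≤ n)
    (h2 : n ≤ (K + 1) * W) : 0 < S d k n W := by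
  induction W generalizing n with
  | zero =>
    rw [S_pos_iff]
    exact ⟨[], mem_inputsW.2 ⟨mem_weightStrings_zero.2 rfl, by simp; omega⟩⟩
  | succ W ih =>
    obtain ⟨i, hi1, hi2, hi3, hi4, hi5⟩ : ∃ i, d + 1 ≤ i ∧ i ≤ K + 1 ∧ i ≤ n ∧
        (d + 1) * W ≤ n - i ∧ n - i ≤ (K + 1) * W := by
      have h3 : (d + 1) * W ≤ (K + 1) * W := by gcongr
      rw [mul_add, mul_one] at h1 h2
      -- The last block is as long as possible, subject to leaving (d+1)W for the other W blocks.
      rcases le_total (K + 1) (n - (d + 1) * W) with h | h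
      · exact ⟨K + 1, by omega⟩
      · exact ⟨n - (d + 1) * W, by omega⟩
    have hb : 0 < S d k i 1 :=
      S_pos_iff.2 ⟨block i, mem_inputsW.2 ⟨block_mem_weightStrings
        ⟨i, mem_parts_of_le hK hi1 hi2⟩, length_block (⟨i, mem_parts_of_le hK hi1 hi2⟩ : parts d k)⟩⟩
    have := (ih hi4 hi5).trans_le (S_le_S_add hb)
    rwa [Nat.sub_add_cancel hi3] at this

/-- Chebyshev's inequality: some length within `r` of the mean carries a large share. -/
lemma exists_large_S {μ v r : ℝ} (hdk : (d : ℕ∞) < k) (hx : x ∈ domain d k)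
    (hμ : HasSum (fun i : parts d k => x ^ (i : ℕ) * ((i : ℕ) - μ)) 0)
    (hv : HasSum (fun i : parts d k => x ^ (i : ℕ) * ((i : ℕ) - μ) ^ 2) v) {W N : ℕ}
    (hr : 0 < r) (hrW : 4 * (W * (v / genSum d k x)) ≤ r ^ 2) (hN : μ * W + r < N) :
    ∃ n : ℕ, |(n : ℝ) - μ * W| ≤ r ∧ genSum d k x ^ W ≤ S d k n W * x ^ n * (2 * N) := by
  by_contra! hcon
  have hG : 0 < genSum d k x ^ W := pow_pos (genSum_pos hdk hx) W
  set G := genSum d k x ^ W with hGdef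
  have h1 := hasSum_S_pow hx W
  have h2 := hasSum_S (F := fun n => x ^ n * ((n : ℝ) - μ * W) ^ 2)
    (hasSum_weightStrings_sq hx hμ hv W).2
  have h3 : HasSum (fun n => if n ∈ Finset.range N then G / (2 * N) else 0)
      (∑ n ∈ Finset.range N, G / (2 * N)) := by
    have : HasSum (fun n => if n ∈ Finset.range N then G / (2 * N) else 0)
        (∑ n ∈ Finset.range N, if n ∈ Finset.range N then G / (2 * N) else 0) :=
      hasSum_sum_of_ne_finset_zero fun n hn => if_neg hn
    rwa [Finset.sum_congr rfl fun n hn => if_pos hn] at this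
  have h4 := h3.add (h2.div_const (r ^ 2))
  -- If the claim fails, each term within r of the mean is below G/(2N), and such n are less than N,
  -- so together they give at most G/2. Terms outside are dominated by the second moment over r^2,
  -- at most G/4 by `hrW`. The total is less than G.
  have hle : G ≤ _ := hasSum_le (fun n => ?_) h1 h4
  · rw [Finset.sum_const, Finset.card_range, nsmul_eq_mul] at hle
    have e1 : (N : ℝ) * (G / (2 * N)) ≤ G / 2 := by
      rcases Nat.eq_zero_or_pos N with h | h
      · rw [h, Nat.cast_zero, zero_mul]; exact (half_pos hG).le
      · have : (0 : ℝ) < N := by exact_mod_cast h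
        apply le_of_eq; field_simp
    have e2 : W * (v * G / genSum d k x) / r ^ 2 ≤ G / 4 := by
      rw [div_le_iff₀ (by positivity)]
      have : W * (v * G / genSum d k x) = (W * (v / genSum d k x)) * G := by ring
      rw [this]
      nlinarith
    linarith
  · have hS : 0 ≤ (S d k n W : ℝ) * x ^ n := mul_nonneg (Nat.cast_nonneg _) (pow_pos hx.1 _).le
    by_cases hn : |(n : ℝ) - μ * W| ≤ r
    · have hnN : n < N := by
        have := (abs_le.1 hn).2
        exact_mod_cast (by linarith : (n : ℝ) < N)
      have hN0 : (0 : ℝ) < 2 * N := by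
        have : (0 : ℝ) < N := by exact_mod_cast (Nat.zero_le n).trans_lt hnN
        linarith
      rw [if_pos (Finset.mem_range.2 hnN)]
      have a1 := (le_div_iff₀ hN0).2 (hcon n hn).le
      have a2 : 0 ≤ (S d k n W : ℝ) * (x ^ n * ((n : ℝ) - μ * W) ^ 2) / r ^ 2 := by
        rw [← mul_assoc]; positivity
      linarith
    · have b1 : 0 ≤ if n ∈ Finset.range N then G / (2 * N) else 0 := by
        split_ifs
        · positivity
        · exact le_rfl
      have b2 : (S d k n W : ℝ) * x ^ n ≤
          (S d k n W : ℝ) * (x ^ n * ((n : ℝ) - μ * W) ^ 2) / r ^ 2 := by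
        rw [le_div_iff₀ (by positivity), ← mul_assoc]
        refine mul_le_mul_of_nonneg_left ?_ hS
        rw [← sq_abs ((n : ℝ) - _)]
        exact pow_le_pow_left₀ hr.le (not_le.1 hn).le 2
      linarith

/-! ### The upper bound on the growth rate -/

lemma log_S_le (hx : x ∈ domain d k) {n W : ℕ} (hS : 0 < S d k n W) :
    Real.log (S d k n W) ≤ W * Real.log (genSum d k x) - n * Real.log x := by
  have hS' : (0 : ℝ) < S d k n W := by exact_mod_cast hS
  have h := Real.log_le_log (mul_pos hS' (pow_pos hx.1 n)) (S_mul_pow_le hx n W)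
  rw [Real.log_mul hS'.ne' (pow_pos hx.1 n).ne', Real.log_pow, Real.log_pow] at h
  linarith

lemma log_S_le_expo (hx : x ∈ domain d k) {n W : ℕ}
    (hW : |(W : ℝ) - w * n| ≤ 1) (hS : 0 < S d k n W) :
    Real.log (S d k n W) ≤ n * expo d k w x + |Real.log (genSum d k x)| := by
  have h := log_S_le hx hS
  have h2 : ((W : ℝ) - w * n) * Real.log (genSum d k x) ≤ |Real.log (genSum d k x)| := by
    refine (le_abs_self _).trans ?_
    rw [abs_mul]
    exact mul_le_of_le_one_left (abs_nonneg _) hW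
  unfold expo
  linarith

lemma growth_le (hx : x ∈ domain d k) {n W : ℕ} (hn : 0 < n)
    (hW : |(W : ℝ) - w * n| ≤ 1) (hS : 0 < S d k n W) :
    1 / (n : ℝ) * Real.logb 2 (S d k n W) ≤
      (expo d k w x + |Real.log (genSum d k x)| / n) / Real.log 2 := by
  have hn' : (0 : ℝ) < n := by exact_mod_cast hn
  have h := log_S_le_expo hx hW hS
  rw [Real.logb, ← mul_div_assoc]
  refine div_le_div_of_nonneg_right ?_ (Real.log_pos one_lt_two).le
  rw [one_div_mul_eq_div, div_le_iff₀ hn', add_mul, div_mul_cancel₀ _ hn'.ne']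
  linarith

lemma tendsto_growth_bound (a b : ℝ) :
    Tendsto (fun n : ℕ => (a + b / n) / Real.log 2) atTop (𝓝 (a / Real.log 2)) := by
  have := (tendsto_const_div_atTop_nhds_zero_nat b).const_add a
  rw [add_zero] at this
  exact this.div_const _

/-! ### Positivity of the counts -/

/-- For k = ∞, blocks may be truncated at a finite length K+1 that still exceeds 1/w. -/
lemma exists_coe_le_of_wMin_lt (hdk : (d : ℕ∞) < k) (hw : wMin k < w) :
    ∃ K : ℕ, d < K ∧ (K : ℕ∞) ≤ k ∧ 1 < w * (K + 1) := by
  induction k using ENat.recTopCoe with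
  | top =>
    rw [wMin_top] at hw
    obtain ⟨K, hK⟩ := exists_nat_gt (1 / w)
    rw [div_lt_iff₀ hw] at hK
    refine ⟨max (d + 1) K, by omega, le_top, ?_⟩
    have : (K : ℝ) ≤ (max (d + 1) K : ℕ) := by exact_mod_cast le_max_right _ _
    nlinarith
  | coe K =>
    rw [wMin_coe, div_lt_iff₀ (by positivity)] at hw
    exact ⟨K, by exact_mod_cast hdk, le_rfl, hw⟩

lemma mul_lt_one_of_lt_wMax (hw : w < wMax d) : w * (d + 1) < 1 := by
  rwa [wMax, lt_div_iff₀ (by positivity)] at hw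

lemma eventually_le_natCast (c : ℝ) : ∀ᶠ n : ℕ in atTop, c ≤ n :=
  tendsto_natCast_atTop_atTop.eventually_ge_atTop c

/-- As w(d+1) < 1 < w(K+1), for large n the linear slack absorbs the rounding errors d+1 and K+1. -/
lemma eventually_S_pos (hdk : (d : ℕ∞) < k) (hw : w ∈ Ioo (wMin k) (wMax d)) {W : ℕ → ℕ}
    (hW : IsRounding w W) : ∀ᶠ n in atTop, 0 < S d k n (W n) := by
  obtain ⟨K, hd, hK, hwK⟩ := exists_coe_le_of_wMin_lt hdk hw.1
  have hwd := mul_lt_one_of_lt_wMax hw.2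
  filter_upwards [eventually_le_natCast ((d + 1) / (1 - w * (d + 1))),
    eventually_le_natCast ((K + 1) / (w * (K + 1) - 1))] with n h1 h2
  rw [div_le_iff₀ (by linarith)] at h1 h2
  obtain ⟨h3, h4⟩ := abs_le.1 (hW n)
  have hd0 : (0 : ℝ) ≤ d := Nat.cast_nonneg d
  have hK0 : (0 : ℝ) ≤ K := Nat.cast_nonneg K
  refine S_pos hd.le hK ?_ ?_
  · have : ((d : ℝ) + 1) * W n ≤ n := by nlinarith
    exact_mod_cast this
  · have : (n : ℝ) ≤ (K + 1) * W n := by nlinarith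
    exact_mod_cast this

/-- Blocks of lengths d+1 and d+2 suffice: (d+2)W > (d+2)(wn - 1) ≥ n once wn ≥ d+2. -/
lemma eventually_S_pos_wMax (hdk : (d : ℕ∞) < k) :
    ∀ᶠ n : ℕ in atTop, 0 < S d k n ⌊wMax d * (n : ℝ)⌋₊ := by
  filter_upwards [eventually_le_natCast ((d + 1) * (d + 2))] with n hn
  have hd0 : (0 : ℝ) < (d : ℝ) + 1 := by positivity
  have h1 := Nat.floor_le (mul_nonneg (wMax_pos d).le (Nat.cast_nonneg n))
  have h2 := Nat.lt_floor_add_one (wMax d * (n : ℝ))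
  generalize ⌊wMax d * (n : ℝ)⌋₊ = W at *
  have e : wMax d * (n : ℝ) * (d + 1) = n := by unfold wMax; field_simp
  have h3 : (d : ℝ) + 2 ≤ wMax d * n := by
    by_contra! h
    nlinarith
  refine S_pos (K := d + 1) (by omega) ?_ ?_ ?_
  · push_cast
    exact Order.add_one_le_of_lt hdk
  · have : ((d : ℝ) + 1) * W ≤ n := by nlinarith
    exact_mod_cast this
  · have : (n : ℝ) ≤ (d + 1 + 1) * W := by nlinarith
    exact_mod_cast this

lemma eventually_S_pos_wMin (hdk : (d : ℕ∞) < k) :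
    ∀ᶠ n : ℕ in atTop, 0 < S d k n (max 1 ⌈wMin k * (n : ℝ)⌉₊) := by
  induction k using ENat.recTopCoe with
  | top =>
    filter_upwards [eventually_ge_atTop (d + 1)] with n hn
    -- For w = 0 the rounded weight is 1, realized by a single block of length n.
    rw [wMin_top, zero_mul, Nat.ceil_zero, max_eq_left zero_le_one]
    exact S_pos (K := n) (by omega) le_top (by omega) (by omega)
  | coe K =>
    have hd : d < K := by exact_mod_cast hdk
    have hK0 : (0 : ℝ) < (K : ℝ) + 1 := by positivity
    filter_upwards [eventually_le_natCast ((K + 1) * (d + 1))] with n hn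
    have h0 : 0 ≤ wMin K * (n : ℝ) := mul_nonneg (wMin_nonneg _) (Nat.cast_nonneg n)
    have h1 := (Nat.le_ceil (wMin K * (n : ℝ))).trans
      (Nat.cast_le.2 (le_max_right 1 _))
    have h2 : ((max 1 ⌈wMin K * (n : ℝ)⌉₊ : ℕ) : ℝ) ≤ wMin K * (n : ℝ) + 1 := by
      rw [Nat.cast_max]
      refine max_le ?_ (Nat.ceil_lt_add_one h0).le
      push_cast
      linarith
    generalize max 1 ⌈wMin K * (n : ℝ)⌉₊ = W at *
    have e : wMin K * (n : ℝ) * (K + 1) = n := by rw [wMin_coe]; field_simp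
    have h3 : (d : ℝ) + 1 ≤ wMin K * n := by
      by_contra! h
      nlinarith
    have hdK : (d : ℝ) + 1 ≤ K := by exact_mod_cast hd
    refine S_pos hd.le le_rfl ?_ ?_
    · have : ((d : ℝ) + 1) * W ≤ n := by nlinarith [Nat.cast_nonneg (α := ℝ) d]
      exact_mod_cast this
    · have : (n : ℝ) ≤ (K + 1) * W := by nlinarith
      exact_mod_cast this

/-! ### The lower bound on the growth rate -/

lemma hasSum_centered (hw : 0 < w) (hx : IsRhoW d k w x) :
    HasSum (fun i : parts d k => x ^ (i : ℕ) * ((i : ℕ) - 1 / w)) 0 := by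
  have h := hx.2.mul_left (1 / w)
  rw [mul_zero] at h
  refine hasSum_of_forall_eq (fun i => ?_) h
  field_simp

lemma summable_centered_sq (hx : x ∈ domain d k) (μ : ℝ) :
    Summable (fun i : parts d k => x ^ (i : ℕ) * ((i : ℕ) - μ) ^ 2) := by
  refine (((summable_pow_mul hx 2).sub ((summable_coe_mul hx).mul_left (2 * μ))).add
    (hx.2.mul_left (μ ^ 2))).congr fun i => ?_
  ring

/-- Lower bound for the number of strings of weight `W` and length `n ≈ W / w`: `W - m` blocks have
a length near its mean under the tilted distribution, and `m` further blocks correct it to `n`. -/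
lemma le_log_S {η v : ℝ} {K n W m : ℕ} (hdk : (d : ℕ∞) < k) (hw : 0 < w) (hx : IsRhoW d k w x)
    (hv : HasSum (fun i : parts d k => x ^ (i : ℕ) * ((i : ℕ) - 1 / w) ^ 2) v)
    (hdK : d < K) (hK : (K : ℕ∞) ≤ k) (hη : 0 < η) (hη1 : d + 1 + 2 * η ≤ 1 / w)
    (hη2 : 1 / w + 2 * η ≤ K + 1) (hW : |(W : ℝ) - w * n| ≤ 1) (hm : 1 / w ≤ η * m)
    (hmW : m ≤ W) (hvar : 4 * (W * (v / genSum d k x)) ≤ (η * m) ^ 2) :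
    n * expo d k w x - ((1 + m) * |Real.log (genSum d k x)| +
      (1 / w + 2 * η) * m * |Real.log x|) - Real.log (2 * (n + 1)) ≤ Real.log (S d k n W) := by
  have hxd := mem_domain_of_isRhoW hw hx
  have hg := genSum_pos hdk hxd
  set μ := 1 / w with hμ
  have hμ0 : 0 < μ := by positivity
  have hm0 : (0 : ℝ) ≤ m := Nat.cast_nonneg m
  have hd0 : (0 : ℝ) ≤ d := Nat.cast_nonneg d
  have hv0 : 0 ≤ v := hv.nonneg fun i => mul_nonneg (pow_pos hx.1 _).le (sq_nonneg _)
  have hηm : 0 < η * m := hμ0.trans_le hm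
  have hWm : ((W - m : ℕ) : ℝ) = W - m := Nat.cast_sub hmW
  have hWn : |μ * W - n| ≤ μ := by
    have : μ * W - n = μ * (W - w * n) := by rw [hμ]; field_simp
    rw [this, abs_mul, abs_of_pos hμ0]
    exact mul_le_of_le_one_right hμ0.le hW
  obtain ⟨hWn1, hWn2⟩ := abs_le.1 hWn
  have hη1m := mul_le_mul_of_nonneg_right hη1 hm0
  have hη2m := mul_le_mul_of_nonneg_right hη2 hm0
  have hdm : 0 ≤ (d : ℝ) * m := mul_nonneg hd0 hm0
  -- The choice N = n+1 works because the m reserved blocks keep the whole window below n+1.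
  obtain ⟨l, hl, hG⟩ := exists_large_S (W := W - m) (N := n + 1) (r := η * m) hdk hxd
    (hasSum_centered hw hx) hv hηm
    (by
      refine le_trans ?_ hvar
      rw [hWm]
      have : 0 ≤ v / genSum d k x := by positivity
      nlinarith)
    (by
      rw [hWm]
      push_cast
      linarith)
  rw [hWm] at hl
  obtain ⟨hl1, hl2⟩ := abs_le.1 hl
  -- The remaining length n - l is μm up to 2ηm: ηm for the Chebyshev window, and μ ≤ ηm for the
  -- rounding of W. By the choice of η, m blocks can realize it.
  have hln1 : l + (d + 1) * m ≤ n := by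
    have : (l : ℝ) + (d + 1) * m ≤ n := by linarith
    exact_mod_cast this
  have hln2 : n ≤ l + (K + 1) * m := by
    have : (n : ℝ) ≤ l + (K + 1) * m := by linarith
    exact_mod_cast this
  have hpos : 0 < S d k (n - l) m := S_pos hdK.le hK (by omega) (by omega)
  have hle := S_le_S_add (n := l) (W := W - m) hpos
  rw [Nat.sub_add_cancel hmW, Nat.add_sub_cancel' (by omega : l ≤ n)] at hle
  have hSl : 0 < S d k l (W - m) := by
    rw [Nat.pos_iff_ne_zero]
    intro h
    rw [h, Nat.cast_zero, zero_mul, zero_mul] at hG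
    exact (pow_pos hg _).not_ge hG
  have hSl' : (0 : ℝ) < S d k l (W - m) := by exact_mod_cast hSl
  have h1 : Real.log (S d k l (W - m)) ≤ Real.log (S d k n W) :=
    Real.log_le_log hSl' (by exact_mod_cast hle)
  have h2 := Real.log_le_log (pow_pos hg _) hG
  have hn1 : (0 : ℝ) < 2 * ((n + 1 : ℕ) : ℝ) := by positivity
  rw [Real.log_mul (mul_pos hSl' (pow_pos hx.1 _)).ne' hn1.ne',
    Real.log_mul hSl'.ne' (pow_pos hx.1 _).ne', Real.log_pow, Real.log_pow, hWm] at h2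
  push_cast at h2
  have h3 : (w * n - (W - m)) * Real.log (genSum d k x) ≤
      (1 + m) * |Real.log (genSum d k x)| := by
    refine (le_abs_self _).trans ?_
    rw [abs_mul]
    refine mul_le_mul_of_nonneg_right ?_ (abs_nonneg _)
    obtain ⟨a, b⟩ := abs_le.1 hW
    exact abs_le.2 ⟨by linarith, by linarith⟩
  have h4 : (l - n : ℝ) * Real.log x ≤ (μ + 2 * η) * m * |Real.log x| := by
    refine (le_abs_self _).trans ?_
    rw [abs_mul]
    refine mul_le_mul_of_nonneg_right ?_ (abs_nonneg _)
    exact abs_le.2 ⟨by linarith, by nlinarith⟩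
  unfold expo
  linarith

/-- With q = n^(1/4), about q^3 = n^(3/4) blocks are reserved: m^2 must dominate the variance, of
order n, while the loss, of order m, must be o(n). -/
lemma eventually_le_log_S (hdk : (d : ℕ∞) < k) (hw : w ∈ Ioo (wMin k) (wMax d))
    (hx : IsRhoW d k w x) {W : ℕ → ℕ} (hW : IsRounding w W) :
    ∃ C : ℝ, ∀ᶠ n : ℕ in atTop,
      n * expo d k w x - C * ((n : ℝ) ^ (1 / 4 : ℝ)) ^ 3 ≤ Real.log (S d k n (W n)) := by
  have hw0 : 0 < w := (wMin_nonneg k).trans_lt hw.1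
  have hxd := mem_domain_of_isRhoW hw0 hx
  have hg := genSum_pos hdk hxd
  obtain ⟨K, hdK, hK, hwK⟩ := exists_coe_le_of_wMin_lt hdk hw.1
  have hwd := mul_lt_one_of_lt_wMax hw.2
  have hd0 : (0 : ℝ) ≤ d := Nat.cast_nonneg d
  have hw1 : w ≤ 1 := by nlinarith
  obtain ⟨v, hv⟩ := summable_centered_sq hxd (1 / w)
  have hv0 : 0 ≤ v := hv.nonneg fun i => mul_nonneg (pow_pos hx.1 _).le (sq_nonneg _)
  have ha : (d : ℝ) + 1 < 1 / w := by rw [lt_div_iff₀ hw0]; linarith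
  have hb : 1 / w < (K : ℝ) + 1 := by rw [div_lt_iff₀ hw0]; linarith
  obtain ⟨η, hη, hη1, hη2⟩ : ∃ η : ℝ, 0 < η ∧ d + 1 + 2 * η ≤ 1 / w ∧ 1 / w + 2 * η ≤ K + 1 := by
    refine ⟨min (1 / w - (d + 1)) (K + 1 - 1 / w) / 2, ?_, ?_, ?_⟩
    · exact half_pos (lt_min (by linarith) (by linarith))
    · have := min_le_left (1 / w - ((d : ℝ) + 1)) (K + 1 - 1 / w)
      linarith
    · have := min_le_right (1 / w - ((d : ℝ) + 1)) (K + 1 - 1 / w)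
      linarith
  have hq : Tendsto (fun n : ℕ => (n : ℝ) ^ (1 / 4 : ℝ)) atTop atTop :=
    (tendsto_rpow_atTop (by norm_num)).comp tendsto_natCast_atTop_atTop
  refine ⟨3 * |Real.log (genSum d k x)| + (1 / w + 2 * η) * 2 * |Real.log x| + 4, ?_⟩
  filter_upwards [hq.eventually_ge_atTop 1, hq.eventually_ge_atTop (1 / w / η),
    hq.eventually_ge_atTop (3 / w), hq.eventually_ge_atTop (8 * (v / genSum d k x) / η ^ 2)]
    with n hq1 hqη hqw hqv
  have hqn : ((n : ℝ) ^ (1 / 4 : ℝ)) ^ 4 = n := by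
    rw [← Real.rpow_natCast, ← Real.rpow_mul (Nat.cast_nonneg n)]
    norm_num
  set q := (n : ℝ) ^ (1 / 4 : ℝ) with hqdef
  rw [div_le_iff₀ hη] at hqη
  rw [div_le_iff₀ hw0] at hqw
  rw [div_le_iff₀ (by positivity)] at hqv
  have hq0 : 0 < q := by linarith
  have hqq : q ≤ q ^ 3 := by nlinarith [sq_nonneg (q - 1)]
  have hq31 : 1 ≤ q ^ 3 := hq1.trans hqq
  set m := ⌈q ^ 3⌉₊ with hm
  have hm1 : q ^ 3 ≤ m := Nat.le_ceil _
  have hm2 : (m : ℝ) ≤ q ^ 3 + 1 := (Nat.ceil_lt_add_one (by positivity)).le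
  obtain ⟨hW1, hW2⟩ := abs_le.1 (hW n)
  have hwn : 3 * q ^ 3 ≤ w * n := by
    rw [← hqn]
    nlinarith
  have h := le_log_S (η := η) (m := m) hdk hw0 hx hv hdK hK hη hη1 hη2 (hW n)
    (by nlinarith)
    (by
      have : (m : ℝ) ≤ W n := by linarith
      exact_mod_cast this)
    (by
      have hW3 : (W n : ℝ) ≤ 2 * q ^ 4 := by
        rw [hqn]
        have : (1 : ℝ) ≤ n := by rw [← hqn]; exact one_le_pow₀ hq1
        nlinarith
      have hvg : 0 ≤ v / genSum d k x := by positivity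
      calc 4 * (W n * (v / genSum d k x)) ≤ 4 * (2 * q ^ 4 * (v / genSum d k x)) := by gcongr
        _ = q ^ 4 * (8 * (v / genSum d k x)) := by ring
        _ ≤ q ^ 4 * (q * η ^ 2) := by gcongr
        _ ≤ q ^ 4 * (q * η ^ 2) * q := le_mul_of_one_le_right (by positivity) hq1
        _ = (η * q ^ 3) ^ 2 := by ring
        _ ≤ (η * m) ^ 2 := by gcongr)
  have hlog : Real.log (2 * (n + 1)) ≤ 4 * q ^ 3 := by
    have h4 : (2 : ℝ) * (n + 1) ≤ 4 * q ^ 4 := by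
      have : (1 : ℝ) ≤ n := by rw [← hqn]; exact one_le_pow₀ hq1
      rw [hqn]; linarith
    have h5 := Real.log_le_log (by positivity) h4
    rw [Real.log_mul (x := 4) (by norm_num) (by positivity), Real.log_pow] at h5
    have h6 := Real.log_le_sub_one_of_pos hq0
    have h7 := Real.log_le_sub_one_of_pos (show (0 : ℝ) < 4 by norm_num)
    push_cast at h5
    linarith
  have e1 : (1 + m) * |Real.log (genSum d k x)| ≤ 3 * q ^ 3 * |Real.log (genSum d k x)| := by
    refine mul_le_mul_of_nonneg_right ?_ (abs_nonneg _)
    linarith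
  have e2 : (1 / w + 2 * η) * m * |Real.log x| ≤ (1 / w + 2 * η) * (2 * q ^ 3) * |Real.log x| := by
    gcongr
    linarith
  linarith

/-! ### The limit -/

theorem tendsto_growth_interior (hdk : (d : ℕ∞) < k) (hw : w ∈ Ioo (wMin k) (wMax d))
    {W : ℕ → ℕ} (hW : IsRounding w W) :
    Tendsto (fun n : ℕ => (1 / (n : ℝ)) * Real.logb 2 (S d k n (W n) : ℝ))
      atTop (𝓝 (sigma d k w)) := by
  have hx := isRhoW_rhoW hw
  have hxd := mem_domain_of_isRhoW ((wMin_nonneg k).trans_lt hw.1) hx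
  rw [sigma_eq_expo hdk hw hx]
  obtain ⟨C, hC⟩ := eventually_le_log_S hdk hw hx hW
  have hq : Tendsto (fun n : ℕ => (n : ℝ) ^ (1 / 4 : ℝ)) atTop atTop :=
    (tendsto_rpow_atTop (by norm_num)).comp tendsto_natCast_atTop_atTop
  have hlow : Tendsto (fun n : ℕ => (expo d k w (rhoW d k w) - C * ((n : ℝ) ^ (1 / 4 : ℝ))⁻¹) /
      Real.log 2) atTop (𝓝 (expo d k w (rhoW d k w) / Real.log 2)) := by
    have := ((tendsto_inv_atTop_zero.comp hq).const_mul C).const_sub (expo d k w (rhoW d k w))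
    rw [mul_zero, sub_zero] at this
    exact this.div_const _
  refine tendsto_of_tendsto_of_tendsto_of_le_of_le' hlow
    (tendsto_growth_bound _ |Real.log (genSum d k (rhoW d k w))|) ?_ ?_
  · filter_upwards [hC, eventually_gt_atTop 0] with n hn hn0
    have hn' : (0 : ℝ) < n := by exact_mod_cast hn0
    have hq0 : 0 < (n : ℝ) ^ (1 / 4 : ℝ) := Real.rpow_pos_of_pos hn' _
    have hqn : ((n : ℝ) ^ (1 / 4 : ℝ)) ^ 4 = n := by
      rw [← Real.rpow_natCast, ← Real.rpow_mul (Nat.cast_nonneg n)]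
      norm_num
    rw [Real.logb, ← mul_div_assoc]
    refine div_le_div_of_nonneg_right ?_ (Real.log_pos one_lt_two).le
    rw [one_div_mul_eq_div, le_div_iff₀ hn']
    refine le_trans (le_of_eq ?_) hn
    generalize (n : ℝ) ^ (1 / 4 : ℝ) = q at *
    rw [← hqn]
    field_simp
  · filter_upwards [eventually_S_pos hdk hw hW, eventually_gt_atTop 0] with n hn hn0
    exact growth_le hxd hn0 (hW n) hn

/-- One admissible string makes the rate nonnegative, and suitable x make the upper bound
arbitrarily small. -/
theorem tendsto_growth_endpoint (hdk : (d : ℕ∞) < k) (hw : w ∈ Icc (wMin k) (wMax d))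
    (hw' : w ∉ Ioo (wMin k) (wMax d)) {W : ℕ → ℕ} (hW : IsRounding w W)
    (hS : ∀ᶠ n in atTop, 0 < S d k n (W n)) :
    Tendsto (fun n : ℕ => (1 / (n : ℝ)) * Real.logb 2 (S d k n (W n) : ℝ))
      atTop (𝓝 (sigma d k w)) := by
  rw [sigma_of_notMem hw', tendsto_order]
  have hl := Real.log_pos one_lt_two
  refine ⟨fun a ha => ?_, fun a ha => ?_⟩
  · filter_upwards [hS] with n hn
    have : (1 : ℝ) ≤ S d k n (W n) := by exact_mod_cast hn
    exact ha.trans_le (mul_nonneg (by positivity) (Real.logb_nonneg one_lt_two this))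
  · obtain ⟨x, hx, hlt⟩ := exists_expo_lt_of_notMem_Ioo hdk hw hw' (mul_pos ha hl)
    filter_upwards [hS, eventually_gt_atTop 0, (tendsto_growth_bound (expo d k w x)
      |Real.log (genSum d k x)|).eventually (gt_mem_nhds ((div_lt_iff₀ hl).2 hlt))] with n hn hn0 hb
    exact (growth_le hx hn0 (hW n) hn).trans_lt hb

end RunLength
end

theorem lemma1 (d : ℕ) (k : ℕ∞) (hdk : (d : ℕ∞) < k) :
    -- the solutions `ρ` and `ρ_w` exist and are unique, and the sum in `σ` converges
    ((∃! x : ℝ, RunLength.IsRho d k x) ∧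
      ∀ w ∈ Ioo (RunLength.wMin k) (RunLength.wMax d),
        (∃! x : ℝ, RunLength.IsRhoW d k w x) ∧
        Summable (fun i : RunLength.parts d k =>
          (RunLength.rhoW d k w) ^ (((i : ℕ) : ℝ) - 1 / w))) ∧
    -- (a) the exponential growth rate, for every rounding of `w n` to an integer weight
    -- for which there are admissible strings
    ((∀ w ∈ Icc (RunLength.wMin k) (RunLength.wMax d),
        ∀ W : ℕ → ℕ, RunLength.IsRounding w W →
        (∀ᶠ n in atTop, 0 < RunLength.S d k n (W n)) →
        Tendsto (fun n : ℕ => (1 / (n : ℝ)) * Real.logb 2 (RunLength.S d k n (W n) : ℝ))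
          atTop (𝓝 (RunLength.sigma d k w))) ∧
      -- in the interior every rounding has this property
      (∀ w ∈ Ioo (RunLength.wMin k) (RunLength.wMax d),
        ∀ W : ℕ → ℕ, RunLength.IsRounding w W →
        ∀ᶠ n in atTop, 0 < RunLength.S d k n (W n)) ∧
      -- at the right endpoint rounding down has it
      (∀ᶠ n : ℕ in atTop, 0 < RunLength.S d k n ⌊RunLength.wMax d * (n : ℝ)⌋₊) ∧
      -- at the left endpoint rounding up (to a positive integer) has it
      (∀ᶠ n : ℕ in atTop, 0 < RunLength.S d k n (max 1 ⌈RunLength.wMin k * (n : ℝ)⌉₊))) ∧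
    -- (b) continuity, strict concavity, the maximizer and the maximum
    (ContinuousOn (RunLength.sigma d k) (Icc (RunLength.wMin k) (RunLength.wMax d)) ∧
      StrictConcaveOn ℝ (Icc (RunLength.wMin k) (RunLength.wMax d)) (RunLength.sigma d k) ∧
      RunLength.wStar d k ∈ Ioo (RunLength.wMin k) (RunLength.wMax d) ∧
      IsMaxOn (RunLength.sigma d k) (Icc (RunLength.wMin k) (RunLength.wMax d))
        (RunLength.wStar d k) ∧
      RunLength.sigma d k (RunLength.wStar d k) = - Real.logb 2 (RunLength.rho d k)) := by
  open RunLength in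
  refine ⟨⟨?_, fun w hw => ⟨?_, ?_⟩⟩, ⟨fun w hw W hW hS => ?_, fun w hw W hW => ?_, ?_, ?_⟩, ?_⟩
  · exact ⟨_, isRho_rho hdk, fun y hy => isRho_unique hdk (isRho_rho hdk) hy⟩
  · exact ⟨_, isRhoW_rhoW hw, fun y hy =>
      isRhoW_unique hdk ((wMin_nonneg k).trans_lt hw.1) (isRhoW_rhoW hw) hy⟩
  · exact summable_rpow_sub
      (mem_domain_of_isRhoW ((wMin_nonneg k).trans_lt hw.1) (isRhoW_rhoW hw))
  · by_cases hw' : w ∈ Ioo (wMin k) (wMax d)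
    · exact tendsto_growth_interior hdk hw' hW
    · exact tendsto_growth_endpoint hdk hw hw' hW hS
  · exact eventually_S_pos hdk hw hW
  · exact eventually_S_pos_wMax hdk
  · exact eventually_S_pos_wMin hdk
  · exact ⟨continuousOn_sigma hdk, strictConcaveOn_sigma hdk, wStar_mem_Ioo hdk,
      isMaxOn_sigma_wStar hdk, sigma_wStar hdk⟩
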